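/- For positive integers $d,k,l$ with $l\le k$, let $f(d,k,l)$ denote the maximum size of a set $P$ of points in the Euclidean space $\mathbb{R}^d$ such that among any $k+1$ points of $P$ there are at least $l+1$ points that are pairwise at unit distance. Then for all positive integers $d,k,l$ with $k\ge 2$ and $l\le k$ this maximum exists (in particular no infinite set has this property), and $$f(d,k,l)\le (3+o(1))^d\,k ,$$ where the $o(1)$ term depends only on $d$ and tends to $0$ as $d\to\infty$. That is, there is a sequence $(\varepsilon_d)_{d\ge 1}$ of real numbers with $\varepsilon_d\to 0$ as $d\to\infty$ such that $f(d,k,l)\le (3+\varepsilon_d)^d\,k$ for all integers $d\ge 1$, $k\ge 2$ and $1\le l\le k$. -/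

import Mathlib

open Filter Topology

/-- Among any `k + 1` (distinct) points of `P` there are `l + 1` points that are pairwise at
unit (Euclidean) distance. -/
def UnitCliqueProperty (d k l : ℕ) (P : Set (EuclideanSpace ℝ (Fin d))) : Prop :=
  ∀ Q : Finset (EuclideanSpace ℝ (Fin d)), (Q : Set (EuclideanSpace ℝ (Fin d))) ⊆ P →
    Q.card = k + 1 →
      ∃ T : Finset (EuclideanSpace ℝ (Fin d)), T ⊆ Q ∧ T.card = l + 1 ∧
        (T : Set (EuclideanSpace ℝ (Fin d))).Pairwise fun x y => dist x y = 1

/-- The largest size `f(d, k, l)` of a point set in `ℝ^d` among any `k + 1` points of which there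
are `l + 1` points pairwise at unit distance. It is an extended natural number, the supremum over
all such sets, finite or infinite; whenever it is finite it is attained, hence a maximum. -/
noncomputable def maxUnitCliqueSize (d k l : ℕ) : ℕ∞ :=
  ⨆ (P : Set (EuclideanSpace ℝ (Fin d))) (_ : UnitCliqueProperty d k l P), P.encard

/-!
Only the case `l = 1` matters, where the hypothesis says that `P` has no `k + 1` points without a
unit distance among them. It yields the bound `3 ^ d * k`, so the error sequence may be taken to
be `0`.

The idea is a fractional form of the Larman–Rogers bound on the chromatic number of `ℝ^d`: a
large ball contains a measurable set `A` without unit distances that fills almost the fraction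
`3⁻ᵈ` of it. To construct `A`, take a maximal `s`-separated set `X` in the ball and shrink each
Voronoi cell of `X` towards its centre by a factor `c`. A cell has radius at most `s`, by
maximality, so two points of one shrunken cell are at distance at most `2cs`
(`dist_homothety_le`). Two distinct cells are separated by a bisector, so points of their shrunken
copies are at distance more than `(1 - c)s` (`dist_le_dist_homothety`). For `c < 1 / 3` and
`s = 1 / (1 - c)` neither distance can be `1`, and shrinking multiplies volumes by `cᵈ`
(`exists_unitDistFree_subset_closedBall`).

A translate of `A` meets `P` in at most `k` points. Averaging over all translates that meet a ball
around `P` gives `|P| cᵈ Lᵈ ≤ k (L + ρ)ᵈ` for every `L`, where `P` lies in the ball of radius `ρ`.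
Letting `L → ∞` and then `c → 1 / 3` gives `|P| ≤ 3ᵈ k` for finite `P`, hence for all `P`.
-/

open MeasureTheory Metric Module AffineMap

section Geometry

variable {E : Type*} [NormedAddCommGroup E] [InnerProductSpace ℝ E]

lemma dist_homothety_le {x a b : E} {c s : ℝ} (hc : 0 ≤ c) (ha : dist a x ≤ s)
    (hb : dist b x ≤ s) : dist (homothety x c a) (homothety x c b) ≤ 2 * c * s := by
  have h : homothety x c a - homothety x c b = c • (a - b) := by
    simp only [homothety_apply, vsub_eq_sub, vadd_eq_add]
    module
  rw [dist_eq_norm, h, norm_smul, Real.norm_of_nonneg hc, ← dist_eq_norm]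
  nlinarith [dist_triangle_right a b x]

/-- If `a` and `b` lie on the sides of `x` and `y` of the bisector of `x` and `y`, then shrinking
`a` towards `x` and `b` towards `y` by the factor `c` leaves a gap of width `(1 - c) * dist x y`. -/
lemma dist_le_dist_homothety {x y a b : E} {c : ℝ} (hc : 0 ≤ c)
    (ha : dist a x ≤ dist a y) (hb : dist b y ≤ dist b x) :
    (1 - c) * dist x y ≤ dist (homothety x c a) (homothety y c b) := by
  have side : ∀ {u v w : E}, dist u v ≤ dist u w → 2 * inner ℝ (u - v) (w - v) ≤ ‖w - v‖ ^ 2 := by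
    intro u v w h
    rw [dist_eq_norm, dist_eq_norm] at h
    have h2 : ‖u - v‖ ^ 2 ≤ ‖u - w‖ ^ 2 := by gcongr
    rw [show u - w = (u - v) - (w - v) by abel, norm_sub_sq_real (u - v)] at h2
    linarith
  have hA := side ha
  have hB := side hb
  set t := y - x with ht
  have hxy : x - y = -t := by rw [ht]; abel
  rw [hxy, inner_neg_right, norm_neg] at hB
  have hdiff : homothety y c b - homothety x c a = t + c • ((b - y) - (a - x)) := by
    simp only [homothety_apply, vsub_eq_sub, vadd_eq_add, ht]
    module
  rw [dist_comm x y, dist_comm (homothety x c a), dist_eq_norm, dist_eq_norm, hdiff, ← ht]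
  have key : (1 - c) * ‖t‖ ^ 2 ≤ inner ℝ (t + c • ((b - y) - (a - x))) t := by
    rw [inner_add_left, real_inner_smul_left, inner_sub_left (b - y), real_inner_self_eq_norm_sq]
    nlinarith
  rcases (norm_nonneg t).eq_or_lt with h0 | h0
  · rw [← h0]
    simp
  · have := key.trans (real_inner_le_norm _ _)
    exact le_of_mul_le_mul_right (by linarith [sq ‖t‖]) h0

variable [FiniteDimensional ℝ E]

lemma exists_finset_separated_cover (L : ℝ) {s : ℝ} (hs : 0 < s) :
    ∃ X : Finset E, (X : Set E) ⊆ closedBall 0 L ∧ (∀ x ∈ X, ∀ y ∈ X, x ≠ y → s < dist x y) ∧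
      ∀ z ∈ closedBall (0 : E) L, ∃ x ∈ X, dist z x ≤ s := by
  set ε : NNReal := s.toNNReal
  have hε : (ε : ℝ) = s := Real.coe_toNNReal s hs.le
  set B := closedBall (0 : E) L
  have hpack : packingNumber ε B ≠ ⊤ := by
    obtain ⟨N, -, hN, hcov⟩ := exists_finite_isCover_of_isCompact (ε := ε / 2)
      (by simpa [ε] using hs) (isCompact_closedBall (0 : E) L)
    have h := (packingNumber_two_mul_le_externalCoveringNumber (ε / 2) B).trans
      hcov.externalCoveringNumber_le_encard
    rw [mul_div_cancel₀ _ (two_ne_zero)] at h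
    exact ne_top_of_le_ne_top hN.encard_lt_top.ne h
  have hfin : (maximalSeparatedSet ε B).Finite := by
    rw [← Set.encard_lt_top_iff, encard_maximalSeparatedSet hpack]
    exact hpack.lt_top
  refine ⟨hfin.toFinset, by simpa using maximalSeparatedSet_subset, ?_, ?_⟩
  · intro x hx y hy hxy
    have h := isSeparated_maximalSeparatedSet (hfin.mem_toFinset.1 hx) (hfin.mem_toFinset.1 hy) hxy
    beta_reduce at h
    rw [edist_nndist] at h
    rw [← hε]
    exact_mod_cast h
  · intro z hz
    have h := isCover_iff_subset_iUnion_closedBall.1 (isCover_maximalSeparatedSet hpack) hz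
    simp only [Set.mem_iUnion, mem_closedBall, hε] at h
    obtain ⟨x, hx, hzx⟩ := h
    exact ⟨x, hfin.mem_toFinset.2 hx, hzx⟩

variable [MeasurableSpace E] [BorelSpace E]

/-- A ball contains a measurable set without unit distances that fills any prescribed fraction
less than `3⁻ᵈ` of it: the union of the shrunken Voronoi cells of a maximal separated set. -/
lemma exists_unitDistFree_subset_closedBall {c : ℝ} (hc : 0 < c) (hc3 : c < 1 / 3) (L : ℝ) :
    ∃ A ⊆ closedBall (0 : E) L, MeasurableSet A ∧ (∀ x ∈ A, ∀ y ∈ A, dist x y ≠ 1) ∧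
      ENNReal.ofReal (c ^ finrank ℝ E) * volume (closedBall (0 : E) L) ≤ volume A := by
  have hc1 : 0 < 1 - c := by linarith
  -- With this `s` the gap between two shrunken cells exceeds `1`; their diameter `2 * c * s` is
  -- then below `1` exactly because `c < 1 / 3`.
  set s : ℝ := 1 / (1 - c) with hs
  have hs0 : 0 < s := by positivity
  have hgap : (1 - c) * s = 1 := by rw [hs]; field_simp
  have hdiam : 2 * c * s < 1 := by nlinarith
  obtain ⟨X, hXB, hsep, hcov⟩ := exists_finset_separated_cover (E := E) L hs0
  let V : E → Set E := fun x ↦ closedBall 0 L ∩ {z | ∀ y ∈ X, dist z x ≤ dist z y}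
  have hVcompact : ∀ x, IsCompact (V x) := fun x ↦ by
    refine (isCompact_closedBall 0 L).inter_right ?_
    simp only [Set.ofPred_forall]
    exact isClosed_biInter fun y _ ↦ isClosed_le (by fun_prop) (by fun_prop)
  have hVrad : ∀ x, ∀ z ∈ V x, dist z x ≤ s := fun x z hz ↦ by
    obtain ⟨y, hy, hzy⟩ := hcov z hz.1
    exact (hz.2 y hy).trans hzy
  have hfar : ∀ x ∈ X, ∀ y ∈ X, x ≠ y → ∀ a ∈ V x, ∀ b ∈ V y,
      1 < dist (homothety x c a) (homothety y c b) := fun x hx y hy hxy a ha b hb ↦ by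
    have h := dist_le_dist_homothety hc.le (ha.2 y hy) (hb.2 x hx)
    nlinarith [hsep x hx y hy hxy]
  have hmeas : ∀ x, MeasurableSet (homothety x c '' V x) := fun x ↦
    ((hVcompact x).image (homothety_continuous x c)).measurableSet
  refine ⟨⋃ x ∈ X, homothety x c '' V x, ?_, X.measurableSet_biUnion fun x _ ↦ hmeas x, ?_, ?_⟩
  · simp only [Set.iUnion_subset_iff]
    rintro x hx _ ⟨a, ha, rfl⟩
    rw [homothety_eq_lineMap]
    exact (convex_closedBall 0 L).lineMap_mem (hXB hx) ha.1 ⟨hc.le, by linarith⟩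
  · intro p hp q hq
    simp only [Set.mem_iUnion] at hp hq
    obtain ⟨x, hx, a, ha, rfl⟩ := hp
    obtain ⟨y, hy, b, hb, rfl⟩ := hq
    rcases eq_or_ne x y with rfl | hxy
    · exact ((dist_homothety_le hc.le (hVrad x a ha) (hVrad x b hb)).trans_lt hdiam).ne
    · exact (hfar x hx y hy hxy a ha b hb).ne'
  · have hdisj : (X : Set E).PairwiseDisjoint fun x ↦ homothety x c '' V x := by
      intro x hx y hy hxy
      refine Set.disjoint_left.2 ?_
      rintro _ ⟨a, ha, rfl⟩ ⟨b, hb, hba⟩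
      have h := hfar x hx y hy hxy a ha b hb
      rw [hba, dist_self] at h
      linarith
    have hsub : closedBall (0 : E) L ⊆ ⋃ x ∈ X, V x := fun z hz ↦ by
      obtain ⟨w, hw, -⟩ := hcov z hz
      obtain ⟨x, hx, hmin⟩ := X.exists_min_image (dist z) ⟨w, hw⟩
      exact Set.mem_biUnion hx ⟨hz, hmin⟩
    rw [measure_biUnion_finset hdisj fun x _ ↦ hmeas x]
    simp only [Measure.addHaar_image_homothety, abs_of_pos (pow_pos hc _)]
    rw [← Finset.mul_sum]
    gcongr
    exact (measure_mono hsub).trans (measure_biUnion_finset_le X V)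

/-- Averaging over translates: if `Q` meets each translate of `A` in at most `k` points, then
`|Q| * vol A` is at most `k` times the volume of the set of relevant translations. -/
lemma card_mul_volume_le {A : Set E} {L ρ : ℝ} {k : ℕ} (hAL : A ⊆ closedBall 0 L)
    (hA : MeasurableSet A) (Q : Finset E) (hQ : (Q : Set E) ⊆ closedBall 0 ρ)
    (hk : ∀ u : E, ∀ T ⊆ Q, (∀ p ∈ T, p + u ∈ A) → T.card ≤ k) :
    (Q.card : ENNReal) * volume A ≤ k * volume (closedBall (0 : E) (L + ρ)) := by
  classical
  have hpre : ∀ p : E, MeasurableSet ((p + ·) ⁻¹' A) := fun p ↦ measurable_const_add p hA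
  calc (Q.card : ENNReal) * volume A
      = ∑ p ∈ Q, volume ((p + ·) ⁻¹' A) := by simp [measure_preimage_add]
    _ = ∑ p ∈ Q, ∫⁻ u, ((p + ·) ⁻¹' A).indicator 1 u := by
        simp only [lintegral_indicator_one (hpre _)]
    _ = ∫⁻ u, ∑ p ∈ Q, ((p + ·) ⁻¹' A).indicator 1 u :=
        (lintegral_finsetSum _ fun p _ ↦ measurable_one.indicator (hpre p)).symm
    _ ≤ ∫⁻ u, (closedBall (0 : E) (L + ρ)).indicator (fun _ ↦ (k : ENNReal)) u := by
        refine lintegral_mono fun u ↦ ?_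
        have hsum : ∑ p ∈ Q, ((p + ·) ⁻¹' A).indicator (1 : E → ENNReal) u
            = ((Q.filter fun p ↦ p + u ∈ A).card : ENNReal) := by
          simp [Set.indicator_apply, Finset.sum_boole]
        rw [hsum]
        by_cases hu : u ∈ closedBall (0 : E) (L + ρ)
        · rw [Set.indicator_of_mem hu]
          exact Nat.cast_le.2
            (hk u _ (Finset.filter_subset _ _) fun p hp ↦ (Finset.mem_filter.1 hp).2)
        · have hempty : (Q.filter fun p ↦ p + u ∈ A) = ∅ := by
            refine Finset.filter_eq_empty_iff.2 fun p hp hpu ↦ hu ?_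
            have h1 := mem_closedBall_zero_iff.1 (hAL hpu)
            have h2 := mem_closedBall_zero_iff.1 (hQ hp)
            rw [mem_closedBall_zero_iff]
            calc ‖u‖ = ‖(p + u) - p‖ := by simp
              _ ≤ L + ρ := (norm_sub_le _ _).trans (add_le_add h1 h2)
          simp [hempty]
    _ = k * volume (closedBall (0 : E) (L + ρ)) :=
        lintegral_indicator_const measurableSet_closedBall _

/-- A finite set whose subsets without unit distances have at most `k` points has at most
`3 ^ d * k` points. -/
lemma card_le_of_unitDistFree_card_le {k : ℕ} (Q : Finset E)
    (hk : ∀ T ⊆ Q, (∀ x ∈ T, ∀ y ∈ T, dist x y ≠ 1) → T.card ≤ k) :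
    Q.card ≤ 3 ^ finrank ℝ E * k := by
  set n := finrank ℝ E
  obtain ⟨ρ, hρ0, hρ⟩ : ∃ ρ : ℝ, 0 < ρ ∧ (Q : Set E) ⊆ closedBall 0 ρ :=
    Q.finite_toSet.isBounded.subset_closedBall_lt 0 0 |>.imp fun _ h ↦ h
  have hball : ∀ c : ℝ, 0 < c → c < 1 / 3 → ∀ L : ℝ, 0 < L →
      (Q.card : ℝ) * (c ^ n * L ^ n) ≤ k * (L + ρ) ^ n := by
    intro c hc hc3 L hL
    obtain ⟨A, hAL, hA, hfree, hvol⟩ := exists_unitDistFree_subset_closedBall (E := E) hc hc3 L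
    have h := card_mul_volume_le (k := k) hAL hA Q hρ fun u T hT hTA ↦
      hk T hT fun x hx y hy ↦ by
        rw [← dist_add_right x y u]
        exact hfree _ (hTA x hx) _ (hTA y hy)
    have h' := (mul_le_mul_right hvol (Q.card : ENNReal)).trans h
    rw [Measure.addHaar_closedBall _ _ hL.le, Measure.addHaar_closedBall _ _ (by positivity),
      ← mul_assoc, ← mul_assoc, ← mul_assoc,
      ENNReal.mul_le_mul_iff_left (measure_ball_pos _ _ one_pos).ne' measure_ball_lt_top.ne,
      mul_assoc, ← ENNReal.ofReal_mul (by positivity), ← ENNReal.ofReal_natCast,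
      ← ENNReal.ofReal_natCast, ← ENNReal.ofReal_mul (by positivity),
      ← ENNReal.ofReal_mul (by positivity), ENNReal.ofReal_le_ofReal_iff (by positivity)] at h'
    exact h'
  have hc : ∀ c : ℝ, 0 < c → c < 1 / 3 → (Q.card : ℝ) * c ^ n ≤ k := by
    intro c hc hc3
    have hlim : Tendsto (fun L : ℝ ↦ (k : ℝ) * (1 + ρ / L) ^ n) atTop (𝓝 k) := by
      simpa using (((tendsto_id.const_div_atTop ρ).const_add 1).pow n).const_mul (k : ℝ)
    refine ge_of_tendsto hlim ((eventually_gt_atTop 0).mono fun L hL ↦ ?_)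
    refine le_of_mul_le_mul_right ?_ (pow_pos hL n)
    calc (Q.card : ℝ) * c ^ n * L ^ n ≤ k * (L + ρ) ^ n := by
          rw [mul_assoc]; exact hball c hc hc3 L hL
      _ = k * (1 + ρ / L) ^ n * L ^ n := by
          rw [mul_assoc, ← mul_pow]
          congr 2
          field_simp
  have hthird : (Q.card : ℝ) * (1 / 3) ^ n ≤ k := by
    have hlim : Tendsto (fun c : ℝ ↦ (Q.card : ℝ) * c ^ n) (𝓝[<] (1 / 3))
        (𝓝 (Q.card * (1 / 3) ^ n)) :=
      (Continuous.tendsto (by fun_prop) _).mono_left nhdsWithin_le_nhds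
    refine le_of_tendsto hlim ?_
    filter_upwards [Ioo_mem_nhdsLT (show (0 : ℝ) < 1 / 3 by norm_num)] with c h
    exact hc c h.1 h.2
  rw [one_div, inv_pow, ← div_eq_mul_inv, div_le_iff₀ (by positivity)] at hthird
  rw [mul_comm]
  exact_mod_cast hthird

end Geometry

lemma UnitCliqueProperty.encard_le {d k l : ℕ} (hl : 1 ≤ l) {P : Set (EuclideanSpace ℝ (Fin d))}
    (hP : UnitCliqueProperty d k l P) : P.encard ≤ (3 ^ d * k : ℕ) := by
  by_contra! hlt
  obtain ⟨Q, hQP, hQ⟩ := Set.exists_subset_encard_eq (Order.add_one_le_of_lt hlt)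
  have hfin : Q.Finite := Set.finite_of_encard_eq_coe (k := 3 ^ d * k + 1) (by exact_mod_cast hQ)
  lift Q to Finset (EuclideanSpace ℝ (Fin d)) using hfin
  rw [Set.encard_coe_eq_coe_finsetCard] at hQ
  have hcard : Q.card = 3 ^ d * k + 1 := by exact_mod_cast hQ
  have h := card_le_of_unitDistFree_card_le (k := k) Q fun T hT hfree ↦ by
    by_contra! hk
    obtain ⟨U, hUT, hU⟩ := Finset.exists_subset_card_eq (Nat.succ_le_of_lt hk)
    obtain ⟨C, hCU, hC, hunit⟩ := hP U
      ((Finset.coe_subset.2 (hUT.trans hT)).trans hQP) hU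
    obtain ⟨x, hx, y, hy, hxy⟩ := Finset.one_lt_card.1 (by omega : 1 < C.card)
    exact hfree x (hUT (hCU hx)) y (hUT (hCU hy)) (hunit hx hy hxy)
  rw [finrank_euclideanSpace_fin] at h
  omega

theorem mainTheorem10 :
    ∃ ε : ℕ → ℝ, Tendsto ε atTop (𝓝 0) ∧
      ∀ d k l : ℕ, 1 ≤ d → 2 ≤ k → 1 ≤ l → l ≤ k →
        ∃ n : ℕ, maxUnitCliqueSize d k l = (n : ℕ∞) ∧ (n : ℝ) ≤ (3 + ε d) ^ d * (k : ℝ) := by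
  refine ⟨fun _ ↦ 0, tendsto_const_nhds, fun d k l _ _ hl _ ↦ ?_⟩
  have hle : maxUnitCliqueSize d k l ≤ (3 ^ d * k : ℕ) := iSup₂_le fun _ hP ↦ hP.encard_le hl
  obtain ⟨n, hn, hnle⟩ := ENat.le_natCast_iff.1 hle
  refine ⟨n, hn, ?_⟩
  rw [add_zero]
  exact_mod_cast hnle
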